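/- Let $X$ be a ($\sigma$-compact Hausdorff, finite-dimensional) smooth manifold, $\mu$ a Borel measure on $X$, and $L$ a diffusion operator on $X$ (locally $L=\sum a_{ij}\partial_{ij}+\sum b_i\partial_i$ with $(a_{ij})$ symmetric positive semidefinite) whose coefficients are smooth on an open set of full measure. Put $\Gamma(f,g)=\frac12(L(fg)-fLg-gLf)$ and $\Gamma(f)=\Gamma(f,f)$. Let $Q\in\mathbb R$, $Q\ne2$, and let $\psi\ge0$ be a function on $X$ that is smooth and non-zero almost everywhere and satisfies $$L\psi=\frac{Q-1}{\psi}\,\Gamma(\psi)\qquad\text{almost everywhere.}$$ Put $W=\psi^{(Q-2)/2}$, let $X'$ be the open set of points near which the coefficients of $L$ and the function $W$ are smooth and at which $W>0$, and let $\mathcal A_0=C_c^\infty(X')$. Assume that $\mu$ is finite on compact subsets of $X'$ and reversible, i.e. $\int fLg\,d\mu=-\int\Gamma(f,g)\,d\mu$ for $f,g\in\mathcal A_0$. Let $(P_t)_{t\ge0}$ be a strongly continuous semigroup of symmetric contractions on a closed subspace $\mathcal H\subseteq L^2(\mu)$ which is sub-Markov ($P_tu\le1$ if $u\le1$, and $\int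 P_tu\,d\mu\le\int u\,d\mu$ if $u\ge0$), and whose generator is a realisation of $L$: its domain contains $\mathcal A_0\cap\mathcal H$, on which it equals $L$, and on its whole domain it acts as $L$ in the sense of distributions on $X'$, tested against $\mathcal A_0$ with respect to $\mu$. (If $\mathcal A_0\subseteq\mathcal H$, this says that the generator is a self-adjoint extension of $L$ on $\mathcal A_0$.) Let $\mathcal A_0(W)$ be the set of all $f\in\mathcal A_0\cap\mathcal H$ such that $$LP_s\big(W^2(P_tf)^2\big)=P_sL\big(W^2(P_tf)^2\big)\qquad\text{for all } s,t>0,$$ where on the left $L$ is the generator, on the right it is the differential operator, and it is part of the condition that the expressions make sense: $P_tf$ is smooth on $X'$ and $L(W^2(P_tf)^2)\in\mathcal H$ for $t>0$, $W^2(P_tf)^2\in\mathcal H$ for $t\ge0$, and $t\mapsto W^2(P_tf)^2\in\mathcal H$ is continuous on $[0,\infty)$ and differentiable on $(0,\infty)$. Then the following are equivalent: 1. for all $f\in\mathcal A_0(W)$ and $t\ge0$, $\ \|\psi^{(Q-2)/2}P_tf\|_{L^2(\mu)}\le\|\psi^{(Q-2)/2}f\|_{L^2(\mu)}$; 2. for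 all $f\in\mathcal A_0(W)$, $$\int\psi^{Q-2}\frac{\Gamma(\psi)}{\psi^2}f^2\,d\mu\le\Big(\frac1{Q-2}\Big)^2\int\psi^{Q-2}\Gamma(f)\,d\mu;$$ 3. for all $\alpha\in\mathbb R$ with $Q+\alpha\ne2$ and all $f\in\mathcal A_0(W)$, $$\int\psi^{\alpha}\frac{\Gamma(\psi)}{\psi^2}f^2\,d\mu\le\Big(\frac2{Q+\alpha-2}\Big)^2\int\psi^{\alpha}\Gamma(f)\,d\mu.$$ Moreover, for each single $\alpha$ with $Q+\alpha\ne2$, statement 2 is equivalent to the inequality in 3 for this $\alpha$ and all $f\in\mathcal A_0(W)$. -/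

import Mathlib

open MeasureTheory Filter Set
open scoped Manifold ContDiff Topology

namespace WeightedHardy

/-- `f` is smooth at `x`, i.e. smooth in a neighbourhood of `x`. -/
def SmoothNear (E : Type*) [NormedAddCommGroup E] [NormedSpace ℝ E]
    {X : Type*} [TopologicalSpace X] [ChartedSpace E X] (f : X → ℝ) (x : X) : Prop :=
  ∀ᶠ y in 𝓝 x, ContMDiffAt 𝓘(ℝ, E) 𝓘(ℝ, ℝ) ∞ f y

/-- The space `C_c^∞(Ω)`, as functions on the whole of `X`. -/
def testFunctions (E : Type*) [NormedAddCommGroup E] [NormedSpace ℝ E]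
    {X : Type*} [TopologicalSpace X] [ChartedSpace E X] (Ω : Set X) : Set (X → ℝ) :=
  {f | ContMDiff 𝓘(ℝ, E) 𝓘(ℝ, ℝ) ∞ f ∧ HasCompactSupport f ∧ tsupport f ⊆ Ω}

/-- The carré du champ `Γ(f, g) = (L(fg) - f Lg - g Lf) / 2` of an operator `L`. -/
noncomputable def carreDuChamp {X : Type*} (L : (X → ℝ) → X → ℝ) (f g : X → ℝ) (x : X) : ℝ :=
  (L (fun y => f y * g y) x - f x * L g x - g x * L f x) / 2

/-- A diffusion operator `L` on the manifold `X`, with smooth coefficients on the open set `reg`: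
a local linear operator with nonnegative carré du champ that preserves smoothness and satisfies
the chain rule `L φ(f) = φ'(f) L f + φ''(f) Γ(f, f)`. In local coordinates on `reg` these are
exactly the operators `∑ aᵢⱼ ∂ᵢⱼ + ∑ bᵢ ∂ᵢ` with smooth coefficients and `(aᵢⱼ)` symmetric
positive semidefinite. The values of `L f` at points of non-smoothness of `f`, or outside `reg`,
carry no information. -/
structure DiffusionOperator (E : Type*) [NormedAddCommGroup E] [NormedSpace ℝ E]
    (X : Type*) [TopologicalSpace X] [ChartedSpace E X] where
  reg : Set X
  isOpen_reg : IsOpen reg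
  L : (X → ℝ) → X → ℝ
  congr_near : ∀ x ∈ reg, ∀ f g : X → ℝ, f =ᶠ[𝓝 x] g → L f x = L g x
  smooth : ∀ x ∈ reg, ∀ f : X → ℝ, SmoothNear E f x → SmoothNear E (L f) x
  map_add : ∀ x ∈ reg, ∀ f g : X → ℝ, SmoothNear E f x → SmoothNear E g x →
    L (fun y => f y + g y) x = L f x + L g x
  map_smul : ∀ x ∈ reg, ∀ (c : ℝ) (f : X → ℝ), SmoothNear E f x →
    L (fun y => c * f y) x = c * L f x
  chain_rule : ∀ x ∈ reg, ∀ f : X → ℝ, SmoothNear E f x → ∀ φ : ℝ → ℝ, ContDiff ℝ ∞ φ →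
    L (fun y => φ (f y)) x =
      deriv φ (f x) * L f x + deriv (deriv φ) (f x) * carreDuChamp L f f x
  gamma_nonneg : ∀ x ∈ reg, ∀ f : X → ℝ, SmoothNear E f x → 0 ≤ carreDuChamp L f f x

section Triple

variable {E : Type*} [NormedAddCommGroup E] [NormedSpace ℝ E]
  {X : Type*} [TopologicalSpace X] [ChartedSpace E X]

/-- The carré du champ of a diffusion operator. -/
noncomputable def DiffusionOperator.Γ (D : DiffusionOperator E X) (f g : X → ℝ) : X → ℝ :=
  carreDuChamp D.L f g

/-- The set `X'` of points at which `L` and `W` are smooth and `W > 0`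
(so that `W⁻¹` is smooth and positive as well). -/
def DiffusionOperator.regularSet (D : DiffusionOperator E X) (W : X → ℝ) : Set X :=
  {x | x ∈ D.reg ∧ SmoothNear E W x ∧ 0 < W x}

/-- `μ` is finite on compact subsets of `Ω`, and reversible for `L` there: the integration by
parts formula `∫ f L g dμ = - ∫ Γ(f, g) dμ` holds on `C_c^∞(Ω)`. -/
structure DiffusionOperator.IsReversible [MeasurableSpace X]
    (D : DiffusionOperator E X) (μ : Measure X) (Ω : Set X) : Prop where
  finite_on_compacts : ∀ K : Set X, IsCompact K → K ⊆ Ω → μ K < ⊤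
  integration_by_parts : ∀ f ∈ testFunctions E Ω, ∀ g ∈ testFunctions E Ω,
    ∫ x, f x * D.L g x ∂μ = - ∫ x, D.Γ f g x ∂μ

end Triple

/-- A strongly continuous semigroup of symmetric contractions on a subspace `𝓗` of `L²(μ)`
(equivalently, the semigroup generated by a nonpositive self-adjoint operator on `𝓗`) that is
sub-Markov: `P_t u ≤ 1` whenever `u ≤ 1`, and `P_t` does not increase mass. -/
structure SubMarkovSemigroup {X : Type*} [MeasurableSpace X] (μ : Measure X)
    (𝓗 : Submodule ℝ (Lp ℝ 2 μ)) where
  P : ℝ → 𝓗 →L[ℝ] 𝓗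
  zero : ∀ u : 𝓗, P 0 u = u
  add : ∀ s t : ℝ, 0 ≤ s → 0 ≤ t → ∀ u : 𝓗, P (s + t) u = P s (P t u)
  continuousOn : ∀ u : 𝓗, ContinuousOn (fun t => P t u) (Ici 0)
  contraction : ∀ t : ℝ, 0 ≤ t → ∀ u : 𝓗, ‖P t u‖ ≤ ‖u‖
  symmetric : ∀ t : ℝ, 0 ≤ t → ∀ u v : 𝓗, inner ℝ (P t u) v = inner ℝ u (P t v)
  le_one : ∀ t : ℝ, 0 ≤ t → ∀ u : 𝓗,
    (∀ᵐ x ∂μ, (u : Lp ℝ 2 μ) x ≤ 1) → ∀ᵐ x ∂μ, (P t u : Lp ℝ 2 μ) x ≤ 1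
  mass_le : ∀ t : ℝ, 0 ≤ t → ∀ u : 𝓗, (∀ᵐ x ∂μ, 0 ≤ (u : Lp ℝ 2 μ) x) →
    ∫⁻ x, ENNReal.ofReal ((P t u : Lp ℝ 2 μ) x) ∂μ ≤ ∫⁻ x, ENNReal.ofReal ((u : Lp ℝ 2 μ) x) ∂μ

section Semigroup

variable {E : Type*} [NormedAddCommGroup E] [NormedSpace ℝ E]
  {X : Type*} [TopologicalSpace X] [ChartedSpace E X] [MeasurableSpace X]
  {μ : Measure X} {𝓗 : Submodule ℝ (Lp ℝ 2 μ)}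

/-- `u` lies in the domain of the infinitesimal generator of `(P_t)`, which maps it to `v`. -/
def SubMarkovSemigroup.GeneratorEq (T : SubMarkovSemigroup μ 𝓗) (u v : 𝓗) : Prop :=
  Tendsto (fun t : ℝ => t⁻¹ • (T.P t u - u)) (𝓝[>] 0) (𝓝 v)

/-- The generator of `(P_t)` is a realisation of the differential operator `L` in `𝓗`: its domain
contains the elements of `C_c^∞(Ω)` that lie in `𝓗`, where it acts as `L`, and it acts as `L` in
the sense of distributions on `Ω` on its whole domain. (If `C_c^∞(Ω) ⊆ 𝓗` this just says that the
generator is a self-adjoint extension of `L` on `C_c^∞(Ω)`.) -/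
structure SubMarkovSemigroup.IsGeneratedBy (T : SubMarkovSemigroup μ 𝓗)
    (D : DiffusionOperator E X) (Ω : Set X) : Prop where
  extends_L : ∀ φ ∈ testFunctions E Ω, ∀ u : 𝓗, (u : Lp ℝ 2 μ) =ᵐ[μ] φ →
    ∃ v : 𝓗, (v : Lp ℝ 2 μ) =ᵐ[μ] D.L φ ∧ T.GeneratorEq u v
  acts_as_L : ∀ u v : 𝓗, T.GeneratorEq u v → ∀ φ ∈ testFunctions E Ω,
    ∫ x, (v : Lp ℝ 2 μ) x * φ x ∂μ = ∫ x, (u : Lp ℝ 2 μ) x * D.L φ x ∂μ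

/-- The class `A₀(W)` of those `f ∈ C_c^∞(X')`, `f ∈ 𝓗`, for which
`L P_s (W² (P_t f)²) = P_s L (W² (P_t f)²)` for all `s, t > 0`. On the left `L` is the generator;
on the right it is the differential operator, applied to a function that is smooth on `X'`.
Membership comprises that both sides and the time derivative of `W² (P_t f)²` are meaningful:
`g t` is the version of `P_t f` that is smooth on `X'`, and `G t`, `K t` are the elements
`W² (P_t f)²` and `L (W² (P_t f)²)` of `𝓗`. -/
def techClass (D : DiffusionOperator E X) (T : SubMarkovSemigroup μ 𝓗) (W : X → ℝ) :
    Set (X → ℝ) :=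
  {f | f ∈ testFunctions E (D.regularSet W) ∧
    ∃ (u : 𝓗) (g : ℝ → X → ℝ) (G K : ℝ → 𝓗),
      (u : Lp ℝ 2 μ) =ᵐ[μ] f ∧
      (∀ t, 0 ≤ t → (T.P t u : Lp ℝ 2 μ) =ᵐ[μ] g t) ∧
      (∀ t, 0 < t → ∀ x ∈ D.regularSet W, SmoothNear E (g t) x) ∧
      (∀ t, 0 ≤ t → (G t : Lp ℝ 2 μ) =ᵐ[μ] fun x => W x ^ 2 * g t x ^ 2) ∧
      (∀ t, 0 < t → (K t : Lp ℝ 2 μ) =ᵐ[μ] D.L (fun x => W x ^ 2 * g t x ^ 2)) ∧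
      (∀ s t, 0 < s → 0 < t → T.GeneratorEq (T.P s (G t)) (T.P s (K t))) ∧
      ContinuousOn G (Ici 0) ∧ DifferentiableOn ℝ G (Ioi 0)}

/-- `‖W P_t f‖_{L²(μ)} ≤ ‖W f‖_{L²(μ)}` for all `t ≥ 0`, where `f` belongs to `𝓗`. -/
def WeightedContraction (T : SubMarkovSemigroup μ 𝓗) (W f : X → ℝ) : Prop :=
  ∀ u : 𝓗, (u : Lp ℝ 2 μ) =ᵐ[μ] f → ∀ t : ℝ, 0 ≤ t →
    eLpNorm (fun x => W x * (T.P t u : Lp ℝ 2 μ) x) 2 μ ≤ eLpNorm (fun x => W x * f x) 2 μ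

/-- `∫ ψ^α Γ(ψ) ψ⁻² f² dμ ≤ C ∫ ψ^α Γ(f) dμ`. -/
def HardyInequality (D : DiffusionOperator E X) (μ : Measure X) (ψ : X → ℝ) (α C : ℝ)
    (f : X → ℝ) : Prop :=
  ∫ x, ψ x ^ α * (D.Γ ψ ψ x / ψ x ^ 2) * f x ^ 2 ∂μ ≤ C * ∫ x, ψ x ^ α * D.Γ f f x ∂μ

end Semigroup

/-- The multiplier `ψ^{(Q-2)/2}`. -/
noncomputable def multiplier {X : Type*} (ψ : X → ℝ) (Q : ℝ) (x : X) : ℝ :=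
  ψ x ^ ((Q - 2) / 2)

end WeightedHardy

/-! All three statements hold outright under the hypotheses, so the equivalences are formal. For `Q
≠ 2` the equation for `ψ` says that `ψ^(2-Q) = W⁻²` is annihilated by `L` almost everywhere; in
terms of `W` this reads `W L W = 3 Γ(W)`.

Hardy (`hardyInequality_of_testFunction`): put `F = ψ^((α-1)/2) f`. Symmetry of `L` makes `∫ (F
L(ψF) - ψF LF)` vanish. With `c = Q + α - 2` this expresses the cross term `∫ ψ^(α-1) f Γ(ψ, f)` as
`-c/2` times the left side of the inequality. Integrating the nonnegative square `ψ^(α-2) |c f ∇ψ +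
2ψ ∇f|²`, read through `Γ`, gives the constant `(2/c)²`.

Contraction (`weightedContraction_of_mul_L_eq`): write `g = P_t f` and `G = W² g²`. The identity `W
L W = 3 Γ(W)` turns `L(W² g²) - 2 W² g L g` into twice the square `|2g ∇W + W ∇g|²`, so `∂ₜ G ≤ L
G`. Hence `s ↦ P_s G(t-s)` increases, `W² (P_t f)² ≤ P_t (W² f²)`, and integration with the mass
bound finishes. The commutation condition in `techClass` is what permits differentiating the
interpolation. -/

namespace WeightedHardy

/-! ### Germs of smooth functions and cutoffs on the real line -/

section SmoothNear

variable {E : Type*} [NormedAddCommGroup E] [NormedSpace ℝ E]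
  {X : Type*} [TopologicalSpace X] [ChartedSpace E X] {f g : X → ℝ} {x : X}

theorem SmoothNear.contMDiffAt (hf : SmoothNear E f x) : ContMDiffAt 𝓘(ℝ, E) 𝓘(ℝ, ℝ) ∞ f x :=
  hf.self_of_nhds

theorem SmoothNear.continuousAt (hf : SmoothNear E f x) : ContinuousAt f x :=
  hf.contMDiffAt.continuousAt

theorem SmoothNear.congr (hf : SmoothNear E f x) (h : g =ᶠ[𝓝 x] f) : SmoothNear E g x := by
  filter_upwards [hf, h.eventuallyEq_nhds] with y hy h' using hy.congr_of_eventuallyEq h'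

theorem SmoothNear.eventually (hf : SmoothNear E f x) : ∀ᶠ y in 𝓝 x, SmoothNear E f y :=
  eventually_eventually_nhds.2 hf

theorem SmoothNear.add (hf : SmoothNear E f x) (hg : SmoothNear E g x) :
    SmoothNear E (fun y => f y + g y) x := by
  filter_upwards [hf, hg] with y h h' using h.add h'

theorem SmoothNear.mul (hf : SmoothNear E f x) (hg : SmoothNear E g x) :
    SmoothNear E (fun y => f y * g y) x := by
  filter_upwards [hf, hg] with y h h' using h.mul h'

theorem smoothNear_const (c : ℝ) : SmoothNear E (fun _ : X => c) x :=
  Eventually.of_forall fun _ => contMDiffAt_const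

theorem SmoothNear.const_mul (c : ℝ) (hf : SmoothNear E f x) :
    SmoothNear E (fun y => c * f y) x :=
  (smoothNear_const c).mul hf

theorem SmoothNear.pow (hf : SmoothNear E f x) (n : ℕ) : SmoothNear E (fun y => f y ^ n) x := by
  filter_upwards [hf] with y h using h.pow n

theorem SmoothNear.comp_of_contDiffOn {φ : ℝ → ℝ} {U : Set ℝ} (hU : IsOpen U)
    (hφ : ContDiffOn ℝ ∞ φ U) (hf : SmoothNear E f x) (hx : f x ∈ U) :
    SmoothNear E (fun y => φ (f y)) x := by
  filter_upwards [hf, hf.continuousAt.eventually_mem (hU.mem_nhds hx)] with y h h'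
  exact ((hφ.contDiffAt (hU.mem_nhds h')).contMDiffAt).comp y h

theorem contDiffOn_rpow_Ioi (p : ℝ) : ContDiffOn ℝ ∞ (fun t : ℝ => t ^ p) (Ioi 0) :=
  fun _ ht => (Real.contDiffAt_rpow_const_of_ne (ne_of_gt ht)).contDiffWithinAt

theorem SmoothNear.rpow (hf : SmoothNear E f x) (hx : 0 < f x) (p : ℝ) :
    SmoothNear E (fun y => f y ^ p) x :=
  hf.comp_of_contDiffOn isOpen_Ioi (contDiffOn_rpow_Ioi p) hx

theorem smoothNear_of_contMDiff (hf : ContMDiff 𝓘(ℝ, E) 𝓘(ℝ, ℝ) ∞ f) : SmoothNear E f x :=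
  Eventually.of_forall hf

end SmoothNear

/-- Multiplying by a bump function does this. It is needed because the chain rule axiom accepts only
outer functions smooth on all of `ℝ`, which excludes real powers. -/
theorem exists_contDiff_eventuallyEq {φ : ℝ → ℝ} {U : Set ℝ} (hU : IsOpen U)
    (hφ : ContDiffOn ℝ ∞ φ U) {t : ℝ} (ht : t ∈ U) :
    ∃ θ : ℝ → ℝ, ContDiff ℝ ∞ θ ∧ θ =ᶠ[𝓝 t] φ := by
  obtain ⟨r, hr, hrU⟩ := Metric.isOpen_iff.1 hU t ht
  let b : ContDiffBump t := ⟨r / 4, r / 2, by positivity, by linarith⟩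
  refine ⟨fun s => b s * φ s, ?_, ?_⟩
  · rw [contDiff_iff_contDiffAt]
    intro s
    by_cases hs : s ∈ U
    · exact b.contDiffAt.mul (hφ.contDiffAt (hU.mem_nhds hs))
    · have h0 : (fun s => b s * φ s) =ᶠ[𝓝 s] fun _ => 0 := by
        have : s ∉ tsupport b := by
          rw [b.tsupport_eq]
          intro h
          exact hs (hrU (Metric.closedBall_subset_ball (by change r / 2 < r; linarith) h))
        filter_upwards [notMem_tsupport_iff_eventuallyEq.1 this] with y hy
        simp [hy]
      exact contDiffAt_const.congr_of_eventuallyEq h0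
  · filter_upwards [b.eventuallyEq_one] with y hy
    simp [hy]

/-! ### Algebra of `L` and `Γ`: bilinearity, Leibniz rule, powers -/

namespace DiffusionOperator

variable {E : Type*} [NormedAddCommGroup E] [NormedSpace ℝ E]
  {X : Type*} [TopologicalSpace X] [ChartedSpace E X] (D : DiffusionOperator E X)
  {f g h : X → ℝ} {x : X}

theorem L_mul (f g : X → ℝ) (x : X) :
    D.L (fun y => f y * g y) x = f x * D.L g x + g x * D.L f x + 2 * D.Γ f g x := by
  simp only [Γ, carreDuChamp]; ring

theorem Γ_comm (f g : X → ℝ) (x : X) : D.Γ f g x = D.Γ g f x := by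
  simp only [Γ, carreDuChamp, mul_comm (f _) (g _)]; ring

theorem Γ_add_left (hx : x ∈ D.reg) (hf : SmoothNear E f x) (hg : SmoothNear E g x)
    (hh : SmoothNear E h x) :
    D.Γ (fun y => f y + g y) h x = D.Γ f h x + D.Γ g h x := by
  simp only [Γ, carreDuChamp, add_mul, D.map_add x hx _ _ hf hg,
    D.map_add x hx _ _ (hf.mul hh) (hg.mul hh)]
  ring

theorem Γ_smul_left (hx : x ∈ D.reg) (c : ℝ) (hf : SmoothNear E f x) (hh : SmoothNear E h x) :
    D.Γ (fun y => c * f y) h x = c * D.Γ f h x := by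
  simp only [Γ, carreDuChamp, mul_assoc, D.map_smul x hx _ _ hf, D.map_smul x hx _ _ (hf.mul hh)]
  ring

theorem Γ_add_right (hx : x ∈ D.reg) (hf : SmoothNear E f x) (hg : SmoothNear E g x)
    (hh : SmoothNear E h x) :
    D.Γ h (fun y => f y + g y) x = D.Γ h f x + D.Γ h g x := by
  rw [Γ_comm, D.Γ_add_left hx hf hg hh, D.Γ_comm f, D.Γ_comm g]

theorem Γ_smul_right (hx : x ∈ D.reg) (c : ℝ) (hf : SmoothNear E f x) (hh : SmoothNear E h x) :
    D.Γ h (fun y => c * f y) x = c * D.Γ h f x := by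
  rw [Γ_comm, D.Γ_smul_left hx c hf hh, D.Γ_comm f]

theorem Γ_linComb (hx : x ∈ D.reg) (hf : SmoothNear E f x) (hg : SmoothNear E g x) (a b : ℝ) :
    D.Γ (fun y => a * f y + b * g y) (fun y => a * f y + b * g y) x =
      a ^ 2 * D.Γ f f x + 2 * a * b * D.Γ f g x + b ^ 2 * D.Γ g g x := by
  have ha := hf.const_mul a
  have hb := hg.const_mul b
  rw [D.Γ_add_left hx ha hb (ha.add hb), D.Γ_smul_left hx a hf (ha.add hb),
    D.Γ_smul_left hx b hg (ha.add hb), D.Γ_add_right hx ha hb hf, D.Γ_add_right hx ha hb hg,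
    D.Γ_smul_right hx a hf hf, D.Γ_smul_right hx b hg hf, D.Γ_smul_right hx a hf hg,
    D.Γ_smul_right hx b hg hg, D.Γ_comm g f]
  ring

/-- Since `a` and `b` are arbitrary constants, they may be values at `x` of other functions. Both
squares in the proof arise from such frozen coefficients. -/
theorem Γ_linComb_nonneg (hx : x ∈ D.reg) (hf : SmoothNear E f x) (hg : SmoothNear E g x)
    (a b : ℝ) : 0 ≤ a ^ 2 * D.Γ f f x + 2 * a * b * D.Γ f g x + b ^ 2 * D.Γ g g x := by
  rw [← D.Γ_linComb hx hf hg]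
  exact D.gamma_nonneg x hx _ ((hf.const_mul a).add (hg.const_mul b))

/-- The Leibniz rule for `Γ` concerns products of three functions, while the chain rule concerns
one. The cubic power links them: polarising it recovers the trilinear identity. -/
theorem L_cube (hx : x ∈ D.reg) (hf : SmoothNear E f x) :
    D.L (fun y => f y * f y * f y) x = 3 * f x ^ 2 * D.L f x + 6 * f x * D.Γ f f x := by
  have h := D.chain_rule x hx f hf (fun t => t ^ 3) (contDiff_id.pow 3)
  have h1 : deriv (fun t : ℝ => t ^ 3) = fun t => 3 * t ^ 2 := by ext t; simp
  have h2 : deriv (fun t : ℝ => 3 * t ^ 2) = fun t => 6 * t := by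
    ext t; simp; ring
  have h3 : (fun y => f y * f y * f y) = fun y => f y ^ 3 := by ext y; ring
  rw [h3, h, h1, h2]
  rfl

/-- Polarisation of `L_cube`. -/
theorem L_mul_mul (hx : x ∈ D.reg) (hf : SmoothNear E f x) (hg : SmoothNear E g x)
    (hh : SmoothNear E h x) :
    D.L (fun y => f y * g y * h y) x =
      f x * g x * D.L h x + f x * h x * D.L g x + g x * h x * D.L f x +
      2 * (f x * D.Γ g h x + g x * D.Γ f h x + h x * D.Γ f g x) := by
  -- the seven cubes
  have key : (fun y => 6 * (f y * g y * h y)) = fun y =>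
      (f y + g y + h y) * (f y + g y + h y) * (f y + g y + h y) +
      (-1) * ((f y + g y) * (f y + g y) * (f y + g y)) +
      (-1) * ((f y + h y) * (f y + h y) * (f y + h y)) +
      (-1) * ((g y + h y) * (g y + h y) * (g y + h y)) +
      f y * f y * f y + g y * g y * g y + h y * h y * h y := by
    ext y; ring
  have hfg := hf.add hg
  have hfh := hf.add hh
  have hgh := hg.add hh
  have hfgh := hfg.add hh
  have c : ∀ {k : X → ℝ}, SmoothNear E k x → SmoothNear E (fun y => k y * k y * k y) x :=
    fun hk => (hk.mul hk).mul hk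
  have e := D.map_smul x hx 6 _ ((hf.mul hg).mul hh)
  have s1 := (c hfgh).add ((c hfg).const_mul (-1))
  have s2 := s1.add ((c hfh).const_mul (-1))
  have s3 := s2.add ((c hgh).const_mul (-1))
  have s4 := s3.add (c hf)
  have s5 := s4.add (c hg)
  rw [key, D.map_add x hx _ _ s5 (c hh), D.map_add x hx _ _ s4 (c hg),
    D.map_add x hx _ _ s3 (c hf), D.map_add x hx _ _ s2 ((c hgh).const_mul (-1)),
    D.map_add x hx _ _ s1 ((c hfh).const_mul (-1)),
    D.map_add x hx _ _ (c hfgh) ((c hfg).const_mul (-1)),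
    D.map_smul x hx _ _ (c hfg), D.map_smul x hx _ _ (c hfh), D.map_smul x hx _ _ (c hgh),
    D.L_cube hx hfgh, D.L_cube hx hfg, D.L_cube hx hfh, D.L_cube hx hgh, D.L_cube hx hf,
    D.L_cube hx hg, D.L_cube hx hh,
    D.map_add x hx _ _ hfg hh, D.map_add x hx _ _ hf hg, D.map_add x hx _ _ hf hh,
    D.map_add x hx _ _ hg hh, D.Γ_add_left hx hfg hh hfgh, D.Γ_add_left hx hf hg hfgh,
    D.Γ_add_left hx hf hg hfg, D.Γ_add_left hx hf hh hfh, D.Γ_add_left hx hg hh hgh,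
    D.Γ_add_right hx hfg hh hf, D.Γ_add_right hx hfg hh hg, D.Γ_add_right hx hfg hh hh,
    D.Γ_add_right hx hf hg hf, D.Γ_add_right hx hf hg hg, D.Γ_add_right hx hf hg hh,
    D.Γ_add_right hx hf hh hf, D.Γ_add_right hx hf hh hh, D.Γ_add_right hx hg hh hg,
    D.Γ_add_right hx hg hh hh, D.Γ_comm g f, D.Γ_comm h f, D.Γ_comm h g] at e
  linarith

/-- The Leibniz rule for the carré du champ. -/
theorem Γ_mul_left (hx : x ∈ D.reg) (hf : SmoothNear E f x) (hg : SmoothNear E g x)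
    (hh : SmoothNear E h x) :
    D.Γ (fun y => f y * g y) h x = f x * D.Γ g h x + g x * D.Γ f h x := by
  have h1 := D.L_mul_mul hx hf hg hh
  have h2 := D.L_mul (fun y => f y * g y) h x
  have h3 := D.L_mul f g x
  rw [h3] at h2
  linarith

/-- The chain rule for outer functions that are smooth on a neighbourhood of `f x` only. -/
theorem chain_rule_of_contDiffOn (hx : x ∈ D.reg) (hf : SmoothNear E f x) {φ : ℝ → ℝ} {U : Set ℝ}
    (hU : IsOpen U) (hφ : ContDiffOn ℝ ∞ φ U) (hfx : f x ∈ U) :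
    D.L (fun y => φ (f y)) x =
      deriv φ (f x) * D.L f x + deriv (deriv φ) (f x) * D.Γ f f x := by
  obtain ⟨θ, hθ, hθφ⟩ := exists_contDiff_eventuallyEq hU hφ hfx
  have h := D.chain_rule x hx f hf θ hθ
  rw [hθφ.deriv_eq, hθφ.deriv.deriv_eq] at h
  rw [← D.congr_near x hx (fun y => θ (f y)) (fun y => φ (f y))
    (hf.continuousAt.eventually hθφ), h]
  rfl

theorem L_rpow (hx : x ∈ D.reg) (hf : SmoothNear E f x) (hfx : 0 < f x) (p : ℝ) :
    D.L (fun y => f y ^ p) x =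
      p * f x ^ (p - 1) * D.L f x + p * (p - 1) * f x ^ (p - 2) * D.Γ f f x := by
  have h := D.chain_rule_of_contDiffOn hx hf isOpen_Ioi (contDiffOn_rpow_Ioi p) hfx
  have h1 : deriv (fun t : ℝ => t ^ p) =ᶠ[𝓝 (f x)] fun t => p * t ^ (p - 1) := by
    filter_upwards [isOpen_Ioi.mem_nhds hfx] with t ht
    exact (Real.hasDerivAt_rpow_const (Or.inl (ne_of_gt ht))).deriv
  have h2 : deriv (fun t : ℝ => p * t ^ (p - 1)) (f x) = p * ((p - 1) * f x ^ (p - 1 - 1)) :=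
    ((Real.hasDerivAt_rpow_const (Or.inl hfx.ne')).const_mul p).deriv
  rw [h, h1.deriv_eq, h1.self_of_nhds, h2, show p - 1 - 1 = p - 2 by ring]
  ring

theorem Γ_rpow_self (hx : x ∈ D.reg) (hf : SmoothNear E f x) (hfx : 0 < f x) (p : ℝ) :
    D.Γ (fun y => f y ^ p) f x = p * f x ^ (p - 1) * D.Γ f f x := by
  -- Evaluate `L(f^(p+1))` both as a power and as the product `f^p · f`; comparison isolates `Γ(f^p,
  -- f)`.
  have h1 := D.L_mul (fun y => f y ^ p) f x
  have h2 : (fun y => f y ^ p * f y) =ᶠ[𝓝 x] fun y => f y ^ (p + 1) := by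
    filter_upwards [hf.continuousAt.eventually_mem (isOpen_Ioi.mem_nhds hfx)] with y hy
    rw [Real.rpow_add hy, Real.rpow_one]
  rw [D.congr_near x hx _ _ h2, D.L_rpow hx hf hfx, D.L_rpow hx hf hfx] at h1
  have e1 : f x ^ (p - 1) = f x ^ (p - 2) * f x := by
    rw [← Real.rpow_add_one hfx.ne']; ring_nf
  have e2 : f x ^ p = f x ^ (p - 2) * f x * f x := by
    rw [← e1, ← Real.rpow_add_one hfx.ne']; ring_nf
  rw [show p + 1 - 1 = p by ring, show p + 1 - 2 = p - 1 by ring, e1, e2] at h1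
  rw [e1]
  linarith

theorem Γ_rpow_rpow (hx : x ∈ D.reg) (hf : SmoothNear E f x) (hfx : 0 < f x) (p : ℝ) :
    D.Γ (fun y => f y ^ p) (fun y => f y ^ p) x =
      p ^ 2 * f x ^ (2 * p - 2) * D.Γ f f x := by
  have h2 : (fun y => f y ^ p * f y ^ p) =ᶠ[𝓝 x] fun y => f y ^ (2 * p) := by
    filter_upwards [hf.continuousAt.eventually_mem (isOpen_Ioi.mem_nhds hfx)] with y hy
    rw [← Real.rpow_add hy]; ring_nf
  have h1 := D.L_mul (fun y => f y ^ p) (fun y => f y ^ p) x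
  rw [D.congr_near x hx _ _ h2, D.L_rpow hx hf hfx, D.L_rpow hx hf hfx] at h1
  have e1 : f x ^ p * f x ^ (p - 2) = f x ^ (2 * p - 2) := by
    rw [← Real.rpow_add hfx]; ring_nf
  have e2 : f x ^ p * f x ^ (p - 1) = f x ^ (2 * p - 1) := by
    rw [← Real.rpow_add hfx]; ring_nf
  have e3 : f x ^ p * (p * f x ^ (p - 1) * D.L f x + p * (p - 1) * f x ^ (p - 2) * D.Γ f f x) =
      p * f x ^ (2 * p - 1) * D.L f x + p * (p - 1) * f x ^ (2 * p - 2) * D.Γ f f x := by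
    rw [← e1, ← e2]; ring
  rw [e3] at h1
  linarith

end DiffusionOperator

/-! ### Test functions, cutoffs and locality -/

section TestFunctions

variable {E : Type*} [NormedAddCommGroup E] [NormedSpace ℝ E]
  {X : Type*} [TopologicalSpace X] [ChartedSpace E X]

theorem isOpen_regularSet (D : DiffusionOperator E X) (W : X → ℝ) : IsOpen (D.regularSet W) := by
  rw [isOpen_iff_eventually]
  rintro x ⟨h1, h2, h3⟩
  filter_upwards [D.isOpen_reg.eventually_mem h1, h2.eventually,
    h2.continuousAt.eventually_mem (isOpen_Ioi.mem_nhds h3)] with y a b c using ⟨a, b, c⟩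

theorem testFunctions_mul_left {Ω : Set X} {f h : X → ℝ} (hf : f ∈ testFunctions E Ω)
    (hh : ∀ x ∈ Ω, SmoothNear E h x) : (fun x => h x * f x) ∈ testFunctions E Ω := by
  obtain ⟨h1, h2, h3⟩ := hf
  refine ⟨fun x => ?_, h2.mul_left, (closure_mono (Function.support_mul_subset_right h f)).trans h3⟩
  by_cases hx : x ∈ tsupport f
  · exact ((hh x (h3 hx)).mul (smoothNear_of_contMDiff h1)).contMDiffAt
  · have h0 : (fun x => h x * f x) =ᶠ[𝓝 x] fun _ => 0 := by
      filter_upwards [notMem_tsupport_iff_eventuallyEq.1 hx] with y hy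
      simp [hy]
    exact contMDiffAt_const.congr_of_eventuallyEq h0

/-- A function that is smooth on `Ω` agrees near a compact subset of `Ω` with a test function. -/
theorem exists_testFunction_eventuallyEq [FiniteDimensional ℝ E] [T2Space X] [SigmaCompactSpace X]
    [IsManifold 𝓘(ℝ, E) ∞ X] {Ω : Set X} (hΩ : IsOpen Ω) {g : X → ℝ}
    (hg : ∀ x ∈ Ω, SmoothNear E g x) {K : Set X} (hK : IsCompact K) (hKΩ : K ⊆ Ω) :
    ∃ k ∈ testFunctions E Ω, ∀ x ∈ K, k =ᶠ[𝓝 x] g := by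
  have := ChartedSpace.locallyCompactSpace E X
  obtain ⟨K', hK', h1, h2⟩ := exists_compact_between hK hΩ hKΩ
  obtain ⟨χ, hχ1, hχ0, -⟩ := exists_contMDiffMap_one_nhds_of_subset_interior (n := ⊤)
    𝓘(ℝ, E) hK.isClosed h1
  have hsupp : tsupport χ ⊆ K' := closure_minimal
    (fun x hx => by_contra fun h => hx (hχ0 x h)) hK'.isClosed
  have hχ : (χ : X → ℝ) ∈ testFunctions E Ω :=
    ⟨χ.contMDiff, HasCompactSupport.of_support_subset_isCompact hK'
      ((subset_tsupport _).trans hsupp), hsupp.trans h2⟩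
  refine ⟨_, testFunctions_mul_left hχ hg, fun x hx => ?_⟩
  filter_upwards [(eventually_nhdsSet_iff_forall.1 hχ1) x hx] with y hy
  simp [hy]

end TestFunctions

namespace DiffusionOperator

variable {E : Type*} [NormedAddCommGroup E] [NormedSpace ℝ E]
  {X : Type*} [TopologicalSpace X] [ChartedSpace E X] (D : DiffusionOperator E X)
  {f g : X → ℝ} {x : X}

theorem smoothNear_Γ (hx : x ∈ D.reg) (hf : SmoothNear E f x) (hg : SmoothNear E g x) :
    SmoothNear E (D.Γ f g) x := by
  have h := (((D.smooth x hx _ (hf.mul hg)).add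
    ((hf.mul (D.smooth x hx _ hg)).const_mul (-1))).add
    ((hg.mul (D.smooth x hx _ hf)).const_mul (-1))).const_mul (1 / 2)
  refine h.congr (Eventually.of_forall fun y => ?_)
  simp only [Γ, carreDuChamp]
  ring

theorem L_zero (hx : x ∈ D.reg) : D.L (fun _ => 0) x = 0 := by
  have h := D.map_smul x hx 0 (fun _ => 0) (smoothNear_const 0)
  simpa using h

theorem L_eq_zero (hx : x ∈ D.reg) (h : x ∉ tsupport f) : D.L f x = 0 := by
  rw [D.congr_near x hx f (fun _ => 0) (notMem_tsupport_iff_eventuallyEq.1 h), D.L_zero hx]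

theorem Γ_eq_zero_right (hx : x ∈ D.reg) (h : x ∉ tsupport g) : D.Γ f g x = 0 := by
  have h0 := notMem_tsupport_iff_eventuallyEq.1 h
  have h1 : (fun y => f y * g y) =ᶠ[𝓝 x] fun _ => 0 := by
    filter_upwards [h0] with y hy
    simp [hy]
  simp [Γ, carreDuChamp, D.L_eq_zero hx h, D.congr_near x hx _ _ h1, D.L_zero hx, h0.self_of_nhds]

end DiffusionOperator

/-! ### Symmetry of `L` under the reversible measure -/

section Symmetry

variable {E : Type*} [NormedAddCommGroup E] [NormedSpace ℝ E]
  {X : Type*} [TopologicalSpace X] [ChartedSpace E X] [MeasurableSpace X]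
  {D : DiffusionOperator E X} {μ : Measure X} {Ω : Set X}

theorem integral_mul_L_comm (hμ : D.IsReversible μ Ω) {f g : X → ℝ} (hf : f ∈ testFunctions E Ω)
    (hg : g ∈ testFunctions E Ω) : ∫ x, f x * D.L g x ∂μ = ∫ x, g x * D.L f x ∂μ := by
  rw [hμ.integration_by_parts f hf g hg, hμ.integration_by_parts g hg f hf]
  simp only [D.Γ_comm f g]

/-- Both integrands see `f` only near the compact support of `g`, where a cutoff replaces `f` by a
test function. -/
theorem integral_mul_L_comm_of_smoothNear [FiniteDimensional ℝ E] [T2Space X]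
    [SigmaCompactSpace X] [IsManifold 𝓘(ℝ, E) ∞ X] (hμ : D.IsReversible μ Ω) (hΩ : ∀ᵐ x ∂μ, x ∈ Ω)
    (hreg : Ω ⊆ D.reg) (hopen : IsOpen Ω) {f g : X → ℝ} (hf : ∀ x ∈ Ω, SmoothNear E f x)
    (hg : g ∈ testFunctions E Ω) : ∫ x, f x * D.L g x ∂μ = ∫ x, g x * D.L f x ∂μ := by
  obtain ⟨k, hk, hkf⟩ := exists_testFunction_eventuallyEq hopen hf hg.2.1 hg.2.2
  have h1 : ∫ x, f x * D.L g x ∂μ = ∫ x, k x * D.L g x ∂μ := by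
    refine integral_congr_ae ?_
    filter_upwards [hΩ] with x hx
    by_cases h : x ∈ tsupport g
    · rw [(hkf x h).self_of_nhds]
    · simp [D.L_eq_zero (hreg hx) h]
  have h2 : ∫ x, g x * D.L f x ∂μ = ∫ x, g x * D.L k x ∂μ := by
    refine integral_congr_ae ?_
    filter_upwards [hΩ] with x hx
    by_cases h : x ∈ tsupport g
    · rw [D.congr_near x (hreg hx) _ _ (hkf x h)]
    · simp [image_eq_zero_of_notMem_tsupport h]
  rw [h1, h2, integral_mul_L_comm hμ hk hg]

end Symmetry

/-! ### Integrability and the weighted Hardy inequality -/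

section Integration

variable {E : Type*} [NormedAddCommGroup E] [NormedSpace ℝ E]
  {X : Type*} [TopologicalSpace X] [T2Space X] [ChartedSpace E X]
  [MeasurableSpace X] [BorelSpace X] {D : DiffusionOperator E X} {μ : Measure X} {Ω : Set X}

theorem integrable_of_continuousAt (hμ : ∀ K : Set X, IsCompact K → K ⊆ Ω → μ K < ⊤)
    (hΩ : ∀ᵐ x ∂μ, x ∈ Ω) {f k : X → ℝ} (hf : f ∈ testFunctions E Ω)
    (hk : ∀ x ∈ Ω, ContinuousAt k x) (hk0 : ∀ x ∈ Ω, x ∉ tsupport f → k x = 0) :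
    Integrable k μ := by
  have hc : IsCompact (tsupport f) := hf.2.1
  have h1 : IntegrableOn k (tsupport f) μ :=
    ContinuousOn.integrableOn_of_subset_isCompact
      (fun x hx => (hk x (hf.2.2 hx)).continuousWithinAt) hc hc.measurableSet subset_rfl
      (hμ _ hc hf.2.2).ne
  refine ((integrable_indicator_iff hc.measurableSet).2 h1).congr ?_
  filter_upwards [hΩ] with x hx
  by_cases h : x ∈ tsupport f
  · simp [h]
  · simp [h, hk0 x hx h]

theorem integrable_mul_L (hμ : D.IsReversible μ Ω) (hΩ : ∀ᵐ x ∂μ, x ∈ Ω) (hreg : Ω ⊆ D.reg)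
    {f g : X → ℝ} (hf : ∀ x ∈ Ω, SmoothNear E f x) (hg : g ∈ testFunctions E Ω) :
    Integrable (fun x => f x * D.L g x) μ :=
  integrable_of_continuousAt hμ.finite_on_compacts hΩ hg
    (fun x hx => ((hf x hx).mul
      (D.smooth x (hreg hx) _ (smoothNear_of_contMDiff hg.1))).continuousAt)
    fun x hx h => by simp [D.L_eq_zero (hreg hx) h]

/-- The weighted Hardy inequality for test functions. -/
theorem hardyInequality_of_testFunction (hμ : D.IsReversible μ Ω) (hΩ : ∀ᵐ x ∂μ, x ∈ Ω)
    (hreg : Ω ⊆ D.reg) {ψ : X → ℝ} {Q α : ℝ} (hα : Q + α ≠ 2)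
    (hψ_pos : ∀ x ∈ Ω, 0 < ψ x) (hψ_smooth : ∀ x ∈ Ω, SmoothNear E ψ x)
    (hψ : ∀ᵐ x ∂μ, D.L ψ x = (Q - 1) / ψ x * D.Γ ψ ψ x)
    {f : X → ℝ} (hf : f ∈ testFunctions E Ω) :
    HardyInequality D μ ψ α ((2 / (Q + α - 2)) ^ 2) f := by
  have hf_smooth : ∀ x, SmoothNear E f x := fun x => smoothNear_of_contMDiff hf.1
  set c := Q + α - 2 with hc
  have hc0 : c ≠ 0 := by rw [hc]; intro h; apply hα; linarith
  -- The exponent is forced by `F² Lψ`, which must carry the weight `ψ^(α-2) Γ(ψ)`; this needs `2b -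
  -- 1 = α - 2`.
  set b := (α - 1) / 2 with hb
  set F : X → ℝ := fun x => ψ x ^ b * f x with hF
  have hF_test : F ∈ testFunctions E Ω :=
    testFunctions_mul_left hf fun x hx => (hψ_smooth x hx).rpow (hψ_pos x hx) b
  have hF_smooth : ∀ x, SmoothNear E F x := fun x => smoothNear_of_contMDiff hF_test.1
  have hG_test : (fun x => ψ x * F x) ∈ testFunctions E Ω :=
    testFunctions_mul_left hF_test hψ_smooth
  set p : X → ℝ := fun x => ψ x ^ α * (D.Γ ψ ψ x / ψ x ^ 2) * f x ^ 2 with hp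
  set q : X → ℝ := fun x => ψ x ^ (α - 1) * D.Γ ψ f x * f x with hq
  set r : X → ℝ := fun x => ψ x ^ α * D.Γ f f x with hr
  have hp_int : Integrable p μ := by
    refine integrable_of_continuousAt hμ.finite_on_compacts hΩ hf (fun x hx => ?_) fun x hx h => ?_
    · have h1 := ((hψ_smooth x hx).rpow (hψ_pos x hx) α).continuousAt
      have h2 := (D.smoothNear_Γ (hreg hx) (hψ_smooth x hx) (hψ_smooth x hx)).continuousAt
      have h3 := ((hψ_smooth x hx).pow 2).continuousAt
      exact (h1.mul (h2.div h3 (pow_pos (hψ_pos x hx) 2).ne')).mul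
        ((hf_smooth x).pow 2).continuousAt
    · simp [hp, image_eq_zero_of_notMem_tsupport h]
  have hq_int : Integrable q μ := by
    refine integrable_of_continuousAt hμ.finite_on_compacts hΩ hf (fun x hx => ?_) fun x hx h => ?_
    · exact ((((hψ_smooth x hx).rpow (hψ_pos x hx) (α - 1)).mul
        (D.smoothNear_Γ (hreg hx) (hψ_smooth x hx) (hf_smooth x))).mul (hf_smooth x)).continuousAt
    · simp [hq, image_eq_zero_of_notMem_tsupport h]
  have hr_int : Integrable r μ := by
    refine integrable_of_continuousAt hμ.finite_on_compacts hΩ hf (fun x hx => ?_) fun x hx h => ?_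
    · exact (((hψ_smooth x hx).rpow (hψ_pos x hx) α).mul
        (D.smoothNear_Γ (hreg hx) (hf_smooth x) (hf_smooth x))).continuousAt
    · simp [hr, D.Γ_eq_zero_right (hreg hx) h]
  -- integration by parts
  have hibp : c * ∫ x, p x ∂μ + 2 * ∫ x, q x ∂μ = 0 := by
    have h1 := integral_mul_L_comm hμ hF_test hG_test
    have h2 : ∫ x, (F x * D.L (fun x => ψ x * F x) x - ψ x * F x * D.L F x) ∂μ = 0 := by
      rw [integral_sub (integrable_mul_L hμ hΩ hreg (fun x _ => hF_smooth x) hG_test)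
        (integrable_mul_L hμ hΩ hreg
          (fun x hx => (hψ_smooth x hx).mul (hF_smooth x)) hF_test), h1, sub_self]
    rw [← integral_const_mul, ← integral_const_mul,
      ← integral_add (hp_int.const_mul c) (hq_int.const_mul 2), ← h2]
    -- The integrand is `F² Lψ + 2 F Γ(ψ, F)`. Its terms contribute `(Q-1) p` and `2b p + 2q`, and
    -- `Q - 1 + 2b = c`.
    refine integral_congr_ae ?_
    filter_upwards [hΩ, hψ] with x hx hLψ
    have hx' := hreg hx
    have hpos := hψ_pos x hx
    have hs := hψ_smooth x hx
    have e1 : ψ x ^ (b - 1) = ψ x ^ b / ψ x := by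
      rw [Real.rpow_sub hpos, Real.rpow_one]
    have e2 : ψ x ^ α = ψ x ^ b * ψ x ^ b * ψ x := by
      rw [← Real.rpow_add hpos, ← Real.rpow_add_one hpos.ne', hb]; ring_nf
    have e3 : ψ x ^ (α - 1) = ψ x ^ b * ψ x ^ b := by
      rw [← Real.rpow_add hpos, hb]; ring_nf
    rw [D.L_mul ψ F x, D.Γ_comm ψ F, hF, D.Γ_mul_left hx' (hs.rpow hpos b) (hf_smooth x) hs,
      D.Γ_rpow_self hx' hs hpos, D.Γ_comm f ψ, hLψ, ← hF]
    simp only [hp, hq, hF, e1, e2, e3]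
    have : α = 2 * b + 1 := by rw [hb]; ring
    rw [hc, this]
    field_simp
    ring
  have hnonneg : 0 ≤ ∫ x, (c ^ 2 * p x + 4 * c * q x + 4 * r x) ∂μ := by
    refine integral_nonneg_of_ae ?_
    filter_upwards [hΩ] with x hx
    have hpos := hψ_pos x hx
    -- Up to a power of `ψ` this is `Γ(ψ^(c/2) f)`, with coefficients frozen at `x`.
    have h := D.Γ_linComb_nonneg (hreg hx) (hψ_smooth x hx) (hf_smooth x) (c * f x) (2 * ψ x)
    have e1 : ψ x ^ (α - 1) = ψ x ^ α / ψ x := by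
      rw [Real.rpow_sub hpos, Real.rpow_one]
    have e2 : c ^ 2 * p x + 4 * c * q x + 4 * r x = ψ x ^ α / ψ x ^ 2 *
        ((c * f x) ^ 2 * D.Γ ψ ψ x + 2 * (c * f x) * (2 * ψ x) * D.Γ ψ f x +
          (2 * ψ x) ^ 2 * D.Γ f f x) := by
      simp only [hp, hq, hr, e1]
      field_simp
      ring
    simp only [Pi.zero_apply]
    rw [e2]
    exact mul_nonneg (div_nonneg (Real.rpow_nonneg hpos.le _) (sq_nonneg _)) h
  have hpq_int : Integrable (fun x => c ^ 2 * p x + 4 * c * q x) μ :=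
    (hp_int.const_mul _).add (hq_int.const_mul _)
  rw [integral_add hpq_int (hr_int.const_mul _),
    integral_add (hp_int.const_mul _) (hq_int.const_mul _), integral_const_mul,
    integral_const_mul, integral_const_mul] at hnonneg
  have hq_eq : ∫ x, q x ∂μ = -(c * ∫ x, p x ∂μ) / 2 := by linarith
  rw [hq_eq] at hnonneg
  change ∫ x, p x ∂μ ≤ (2 / c) ^ 2 * ∫ x, r x ∂μ
  have hc2 : 0 < c ^ 2 := by positivity
  rw [div_pow, div_mul_eq_mul_div, le_div_iff₀ hc2]
  linarith

end Integration

/-! ### The pointwise inequality behind the contraction -/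

section PointwiseBound

variable {E : Type*} [NormedAddCommGroup E] [NormedSpace ℝ E]
  {X : Type*} [TopologicalSpace X] [ChartedSpace E X] (D : DiffusionOperator E X)
  {x : X}

/-- The difference of the two sides is `2g² (W L W + Γ(W)) + 8 W g Γ(W, g) + 2 W² Γ(g)`. The factor
`3` makes the first term `8g² Γ(W)`, which completes the square with coefficients `2g` and `W`. -/
theorem DiffusionOperator.le_L_sq_mul_sq (hx : x ∈ D.reg) {W g : X → ℝ} (hW : SmoothNear E W x)
    (hg : SmoothNear E g x) (h : W x * D.L W x = 3 * D.Γ W W x) :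
    2 * W x ^ 2 * g x * D.L g x ≤ D.L (fun y => W y ^ 2 * g y ^ 2) x := by
  have h0 : (fun y => W y ^ 2 * g y ^ 2) = fun y => (W y * W y) * (g y * g y) := by
    ext y; ring
  have h1 := D.Γ_linComb_nonneg hx hW hg (2 * g x) (W x)
  rw [h0, D.L_mul (fun y => W y * W y) (fun y => g y * g y), D.L_mul W W, D.L_mul g g,
    D.Γ_mul_left hx hW hW (hg.mul hg), D.Γ_comm W (fun y => g y * g y),
    D.Γ_mul_left hx hg hg hW, D.Γ_comm g W]
  have h2 : g x * g x * (W x * D.L W x) = g x * g x * (3 * D.Γ W W x) := by rw [h]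
  nlinarith

/-- With `p = (Q-2)/2`, the coefficient of `ψ^(2p-2) Γ(ψ)` on the left is `p(Q-1) + p(p-1) = 3p²`.
-/
theorem multiplier_mul_L (hx : x ∈ D.reg) {ψ : X → ℝ} {Q : ℝ} (hψ : SmoothNear E ψ x)
    (hpos : 0 < ψ x) (hL : D.L ψ x = (Q - 1) / ψ x * D.Γ ψ ψ x) :
    multiplier ψ Q x * D.L (multiplier ψ Q) x =
      3 * D.Γ (multiplier ψ Q) (multiplier ψ Q) x := by
  have h1 := D.L_rpow hx hψ hpos ((Q - 2) / 2)
  have h2 := D.Γ_rpow_rpow hx hψ hpos ((Q - 2) / 2)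
  set p := (Q - 2) / 2 with hp
  have e0 : multiplier ψ Q = fun y => ψ y ^ p := rfl
  have e1 : ψ x ^ (p - 1) = ψ x ^ p / ψ x := by rw [Real.rpow_sub hpos, Real.rpow_one]
  have e2 : ψ x ^ (p - 2) = ψ x ^ p / ψ x ^ 2 := by
    rw [Real.rpow_sub hpos]; norm_num
  have e3 : ψ x ^ (2 * p - 2) = ψ x ^ p * ψ x ^ p / ψ x ^ 2 := by
    rw [Real.rpow_sub hpos, two_mul, Real.rpow_add hpos]; norm_num
  have hQ : Q = 2 * p + 2 := by rw [hp]; ring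
  rw [e0, h1, h2, e1, e2, e3, hL, hQ]
  field_simp
  ring

end PointwiseBound

/-! ### Order and differentiation in `L²` -/

section Lp

variable {X : Type*} [MeasurableSpace X] {μ : Measure X}

theorem inner_nonneg_of_ae_nonneg {u v : Lp ℝ 2 μ} (hu : ∀ᵐ x ∂μ, 0 ≤ u x)
    (hv : ∀ᵐ x ∂μ, 0 ≤ v x) : 0 ≤ inner ℝ u v := by
  rw [L2.inner_def]
  refine integral_nonneg_of_ae ?_
  filter_upwards [hu, hv] with x h1 h2
  simpa using mul_nonneg h2 h1

theorem ae_nonneg_of_inner_nonneg {u : Lp ℝ 2 μ}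
    (h : ∀ w : Lp ℝ 2 μ, (∀ᵐ x ∂μ, 0 ≤ w x) → 0 ≤ inner ℝ w u) : ∀ᵐ x ∂μ, 0 ≤ u x := by
  have hw : ∀ᵐ x ∂μ, (Lp.negPart u : Lp ℝ 2 μ) x = max (-u x) 0 :=
    Lp.coeFn_negPart_eq_max u
  -- Tested against its own negative part, `u` gives minus the squared norm of that part.
  have h1 := h (Lp.negPart u) (by filter_upwards [hw] with x hx; rw [hx]; exact le_max_right _ _)
  rw [L2.inner_def] at h1
  have hle : ∀ᵐ x ∂μ, 0 ≤ -inner ℝ ((Lp.negPart u : Lp ℝ 2 μ) x) (u x) := by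
    filter_upwards [hw] with x hx
    rw [hx]
    simp only [RCLike.inner_apply, conj_trivial]
    rcases max_cases (-u x) 0 with ⟨h2, h3⟩ | ⟨h2, h3⟩ <;> rw [h2] <;> nlinarith
  have h2 : ∫ x, -inner ℝ ((Lp.negPart u : Lp ℝ 2 μ) x) (u x) ∂μ = 0 := by
    refine le_antisymm ?_ (integral_nonneg_of_ae hle)
    rw [integral_neg]
    linarith
  rw [integral_eq_zero_iff_of_nonneg_ae hle (L2.integrable_inner _ _).neg] at h2
  filter_upwards [hw, h2] with x hx h3
  rw [hx] at h3
  simp only [RCLike.inner_apply, conj_trivial, Pi.zero_apply] at h3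
  by_contra! hneg
  rw [max_eq_left (by linarith)] at h3
  nlinarith

/-- The derivative in `L²` of `w U(t)²` is `2 w U(t) U'(t)`. -/
theorem ae_eq_of_hasDerivWithinAt_sq {U G : ℝ → Lp ℝ 2 μ} {U' G' : Lp ℝ 2 μ} {w : X → ℝ} {r : ℝ}
    (hU : HasDerivWithinAt U U' (Ioi r) r) (hG : HasDerivWithinAt G G' (Ioi r) r)
    (h : ∀ t, r ≤ t → ∀ᵐ x ∂μ, G t x = w x * U t x ^ 2) :
    ∀ᵐ x ∂μ, G' x = 2 * w x * U r x * U' x := by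
  rw [hasDerivWithinAt_iff_tendsto_slope' self_notMem_Ioi] at hU hG
  have hε : Tendsto (fun n : ℕ => r + 1 / ((n : ℝ) + 1)) atTop (𝓝[>] r) := by
    refine tendsto_nhdsWithin_iff.2 ⟨?_, Eventually.of_forall fun n => ?_⟩
    · simpa using tendsto_one_div_add_atTop_nhds_zero_nat.const_add r
    · have : (0 : ℝ) < 1 / ((n : ℝ) + 1) := by positivity
      simpa using this
  obtain ⟨ns, hns, hUae⟩ :=
    (tendstoInMeasure_of_tendsto_Lp (hU.comp hε)).exists_seq_tendsto_ae
  -- A further subsequence of `ns`, so that the slopes of `U` and of `G` converge pointwise along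
  -- the same indices.
  obtain ⟨ms, hms, hGae⟩ :=
    (tendstoInMeasure_of_tendsto_Lp
      ((hG.comp hε).comp hns.tendsto_atTop)).exists_seq_tendsto_ae
  have hslope : ∀ V : ℝ → Lp ℝ 2 μ, ∀ᵐ x ∂μ, ∀ n : ℕ,
      (slope V r (r + 1 / ((n : ℝ) + 1))) x =
        ((n : ℝ) + 1) * (V (r + 1 / ((n : ℝ) + 1)) x - V r x) := by
    intro V
    rw [ae_all_iff]
    intro n
    have h1 : slope V r (r + 1 / ((n : ℝ) + 1)) =
        ((n : ℝ) + 1) • (V (r + 1 / ((n : ℝ) + 1)) - V r) := by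
      simp [slope_def_module]
    rw [h1]
    filter_upwards [Lp.coeFn_smul ((n : ℝ) + 1) (V (r + 1 / ((n : ℝ) + 1)) - V r),
      Lp.coeFn_sub (V (r + 1 / ((n : ℝ) + 1))) (V r)] with x h2 h3
    rw [h2, Pi.smul_apply, h3, Pi.sub_apply, smul_eq_mul]
  have hGn : ∀ᵐ x ∂μ, ∀ n : ℕ, G (r + 1 / ((n : ℝ) + 1)) x =
      w x * U (r + 1 / ((n : ℝ) + 1)) x ^ 2 := by
    rw [ae_all_iff]
    exact fun n => h _ (by have : (0 : ℝ) < 1 / ((n : ℝ) + 1) := by positivity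
                           linarith)
  filter_upwards [hUae, hGae, hslope U, hslope G, hGn, h r le_rfl] with x h1 h2 h3 h4 h5 h6
  have hk : Tendsto (fun n => ns (ms n)) atTop atTop :=
    hns.tendsto_atTop.comp hms.tendsto_atTop
  have h1' := h1.comp hms.tendsto_atTop
  simp only [Function.comp_def] at h1' h2
  have hinv : Tendsto (fun n => 1 / ((ns (ms n) : ℝ) + 1)) atTop (𝓝 0) :=
    tendsto_one_div_add_atTop_nhds_zero_nat.comp hk
  -- With increment `ε` and slope `S` of `U`, the slope of `w U²` is `w (2U + εS) S`.
  have h7 : Tendsto (fun n => w x * (2 * U r x + 1 / ((ns (ms n) : ℝ) + 1) *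
      (slope U r (r + 1 / ((ns (ms n) : ℝ) + 1))) x) *
      (slope U r (r + 1 / ((ns (ms n) : ℝ) + 1))) x) atTop
      (𝓝 (w x * (2 * U r x + 0 * U' x) * U' x)) :=
    (((hinv.mul h1').const_add _).const_mul _).mul h1'
  have h8 := tendsto_nhds_unique h2 (h7.congr fun n => ?_)
  · rw [h8]; ring
  · rw [h4, h3, h5, h6]
    have : ((ns (ms n) : ℝ) + 1) ≠ 0 := by positivity
    field_simp
    ring

end Lp

/-- Comparison with a constant from each interior point, then continuity at `a`. Only interior right
derivatives are asked for, because the generator is a one-sided limit and the commutation condition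
covers only positive times. -/
theorem le_of_hasDerivWithinAt_nonneg {φ φ' : ℝ → ℝ} {a b : ℝ} (hab : a ≤ b)
    (hφ : ContinuousOn φ (Icc a b))
    (hφ' : ∀ s ∈ Ioo a b, HasDerivWithinAt φ (φ' s) (Ici s) s) (h : ∀ s ∈ Ioo a b, 0 ≤ φ' s) :
    φ a ≤ φ b := by
  rcases hab.eq_or_lt with rfl | hab
  · rfl
  have h1 : ∀ s ∈ Ioo a b, φ s ≤ φ b := fun s hs =>
    image_le_of_deriv_right_le_deriv_boundary (f := fun _ => φ s) (f' := fun _ => 0) (B := φ)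
      (B' := φ') (a := s) (b := b) continuousOn_const
      (fun x _ => hasDerivWithinAt_const x (Ici x) (φ s)) le_rfl
      (hφ.mono (Icc_subset_Icc_left hs.1.le)) (fun x hx => hφ' x ⟨hs.1.trans_le hx.1, hx.2⟩)
      (fun x hx => h x ⟨hs.1.trans_le hx.1, hx.2⟩) (right_mem_Icc.2 hs.2.le)
  have h2 : Tendsto φ (𝓝[>] a) (𝓝 (φ a)) := by
    have := (hφ a (left_mem_Icc.2 hab.le)).mono Ioo_subset_Icc_self
    rwa [ContinuousWithinAt, nhdsWithin_Ioo_eq_nhdsGT hab] at this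
  refine le_of_tendsto h2 ?_
  filter_upwards [Ioo_mem_nhdsGT hab] with s hs using h1 s hs

/-! ### Semigroup calculus and interpolation -/

namespace SubMarkovSemigroup

variable {X : Type*} [MeasurableSpace X] {μ : Measure X} {𝓗 : Submodule ℝ (Lp ℝ 2 μ)}
  (T : SubMarkovSemigroup μ 𝓗)

/-- A sub-Markov semigroup preserves positivity. -/
theorem nonneg {t : ℝ} (ht : 0 ≤ t) {u : 𝓗} (hu : ∀ᵐ x ∂μ, 0 ≤ (u : Lp ℝ 2 μ) x) :
    ∀ᵐ x ∂μ, 0 ≤ (T.P t u : Lp ℝ 2 μ) x := by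
  have hsmul : ∀ (v : 𝓗) (c : ℝ), ∀ᵐ x ∂μ, ((c • v : 𝓗) : Lp ℝ 2 μ) x = c * (v : Lp ℝ 2 μ) x :=
    fun v c => Lp.coeFn_smul c (v : Lp ℝ 2 μ)
  have h : ∀ᵐ x ∂μ, ∀ n : ℕ, -(n : ℝ) * (T.P t u : Lp ℝ 2 μ) x ≤ 1 := by
    rw [ae_all_iff]
    intro n
    -- All multiples `-n u` are at most `0`, hence at most `1`. Letting `n` grow rules out negative
    -- values of `P_t u`.
    have h1 := T.le_one t ht (-(n : ℝ) • u) (by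
      filter_upwards [hsmul u (-(n : ℝ)), hu] with x h1 h2
      rw [h1]
      nlinarith [mul_nonneg (Nat.cast_nonneg (α := ℝ) n) h2])
    rw [map_smul] at h1
    filter_upwards [h1, hsmul (T.P t u) (-(n : ℝ))] with x h2 h3
    rwa [← h3]
  filter_upwards [h] with x hx
  by_contra! hneg
  obtain ⟨n, hn⟩ := exists_nat_gt (1 / -(T.P t u : Lp ℝ 2 μ) x)
  have h1 := hx n
  rw [div_lt_iff₀ (by linarith)] at hn
  linarith

/-- Joint continuity in time and vector: contractivity makes strong continuity uniform under
perturbation of the vector. -/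
theorem tendsto {ι : Type*} {l : Filter ι} {τ : ι → ℝ} {a : ι → 𝓗} {s : ℝ} {b : 𝓗} (hs : 0 ≤ s)
    (hτ : Tendsto τ l (𝓝[Ici 0] s)) (ha : Tendsto a l (𝓝 b)) :
    Tendsto (fun i => T.P (τ i) (a i)) l (𝓝 (T.P s b)) := by
  have h1 : Tendsto (fun i => T.P (τ i) b) l (𝓝 (T.P s b)) :=
    (T.continuousOn b s hs).tendsto.comp hτ
  have h2 : Tendsto (fun i => T.P (τ i) (a i) - T.P (τ i) b) l (𝓝 0) := by
    refine squeeze_zero_norm' ?_ (tendsto_iff_norm_sub_tendsto_zero.1 ha)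
    filter_upwards [hτ self_mem_nhdsWithin] with i hi
    rw [← map_sub]
    exact T.contraction _ hi _
  simpa using h2.add h1

variable {T}

theorem GeneratorEq.map {u v : 𝓗} (h : T.GeneratorEq u v) {r : ℝ} (hr : 0 ≤ r) :
    T.GeneratorEq (T.P r u) (T.P r v) := by
  refine (((T.P r).continuous.tendsto v).comp h).congr' ?_
  filter_upwards [self_mem_nhdsWithin] with t ht
  have ht' : (0 : ℝ) ≤ t := le_of_lt ht
  rw [Function.comp_apply, map_smul, map_sub, ← T.add r t hr ht', ← T.add t r ht' hr, add_comm]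

theorem GeneratorEq.tendsto_sub {u v : 𝓗} (h : T.GeneratorEq u v) (s : ℝ) :
    Tendsto (fun σ : ℝ => (σ - s)⁻¹ • (T.P (σ - s) u - u)) (𝓝[>] s) (𝓝 v) := by
  refine Tendsto.comp (f := fun σ => σ - s) h (tendsto_nhdsWithin_iff.2 ⟨?_, ?_⟩)
  · have : Tendsto (fun σ : ℝ => σ - s) (𝓝 s) (𝓝 (s - s)) :=
      (continuous_id.sub continuous_const).tendsto s
    rw [sub_self] at this
    exact this.mono_left nhdsWithin_le_nhds
  · filter_upwards [self_mem_nhdsWithin] with σ hσ using sub_pos.2 (mem_Ioi.1 hσ)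

theorem GeneratorEq.hasDerivWithinAt {u v : 𝓗} (h : T.GeneratorEq u v) {r : ℝ} (hr : 0 ≤ r) :
    HasDerivWithinAt (fun t => T.P t u) (T.P r v) (Ioi r) r := by
  rw [hasDerivWithinAt_iff_tendsto_slope' self_notMem_Ioi]
  refine ((h.map hr).tendsto_sub r).congr' ?_
  filter_upwards [self_mem_nhdsWithin] with t ht
  rw [slope_def_module, ← T.add (t - r) r (sub_nonneg.2 (le_of_lt ht)) hr, sub_add_cancel]

/-- A product rule: split the increment into `(P_(σ-s) - 1) P_s G(t-s)` and `P_σ` applied to the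
increment of `G`. Only `P_s G(t-s)`, not `G(t-s)` itself, has to lie in the domain of the generator.
-/
theorem hasDerivWithinAt_comp_sub {G : ℝ → 𝓗} {G' v : 𝓗} {s t : ℝ} (hs : 0 ≤ s)
    (hG : HasDerivAt G G' (t - s)) (h : T.GeneratorEq (T.P s (G (t - s))) v) :
    HasDerivWithinAt (fun σ => T.P σ (G (t - σ))) (v - T.P s G') (Ici s) s := by
  rw [← hasDerivWithinAt_Ioi_iff_Ici, hasDerivWithinAt_iff_tendsto_slope' self_notMem_Ioi]
  have h1 : Tendsto (slope (fun σ => G (t - σ)) s) (𝓝[>] s) (𝓝 (-G')) := by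
    have : HasDerivAt (fun σ => G (t - σ)) (-G') s := hG.comp_const_sub t s
    exact (hasDerivWithinAt_iff_tendsto_slope' self_notMem_Ioi).1 this.hasDerivWithinAt
  have h2 := T.tendsto hs (tendsto_id.mono_right
    (nhdsWithin_mono s fun σ hσ => hs.trans (le_of_lt hσ))) h1
  rw [map_neg] at h2
  rw [sub_eq_add_neg]
  refine ((h.tendsto_sub s).add h2).congr' ?_
  filter_upwards [self_mem_nhdsWithin] with σ hσ
  rw [slope_def_module, slope_def_module, ← T.add (σ - s) s (sub_nonneg.2 (le_of_lt hσ)) hs,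
    sub_add_cancel, id, map_smul, map_sub, ← smul_add]
  congr 1
  abel

/-- Interpolation along `s ↦ P_s (G (t - s))`: if `∂ₜ G ≤ L G` then `G t ≤ P_t (G 0)`. -/
theorem ae_nonneg_sub_of_subsolution {G G' K : ℝ → 𝓗} (hG : ContinuousOn G (Ici 0))
    (hG' : ∀ r, 0 < r → HasDerivAt G (G' r) r)
    (hK : ∀ s r, 0 < s → 0 < r → T.GeneratorEq (T.P s (G r)) (T.P s (K r)))
    (hle : ∀ r, 0 < r → ∀ᵐ x ∂μ, 0 ≤ ((K r - G' r : 𝓗) : Lp ℝ 2 μ) x) {t : ℝ} (ht : 0 ≤ t) :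
    ∀ᵐ x ∂μ, 0 ≤ ((T.P t (G 0) - G t : 𝓗) : Lp ℝ 2 μ) x := by
  -- The test vectors `w` range over all of `L²`, since negative parts need not belong to `𝓗`.
  refine ae_nonneg_of_inner_nonneg fun w hw => ?_
  let ℓ : 𝓗 →L[ℝ] ℝ := (innerSL ℝ w).comp 𝓗.subtypeL
  have hℓ : ∀ u : 𝓗, ℓ u = inner ℝ w (u : Lp ℝ 2 μ) := fun u => rfl
  have hcont : ContinuousOn (fun σ => T.P σ (G (t - σ))) (Icc 0 t) := by
    intro s hs
    refine T.tendsto hs.1 (tendsto_id.mono_right (nhdsWithin_mono s Icc_subset_Ici_self)) ?_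
    refine (hG (t - s) (sub_nonneg.2 hs.2)).tendsto.comp (tendsto_nhdsWithin_iff.2 ⟨?_, ?_⟩)
    · exact ((continuous_const.sub continuous_id).tendsto s).mono_left nhdsWithin_le_nhds
    · filter_upwards [self_mem_nhdsWithin] with σ hσ using sub_nonneg.2 hσ.2
  have h1 := le_of_hasDerivWithinAt_nonneg (φ := fun σ => ℓ (T.P σ (G (t - σ))))
    (φ' := fun s => ℓ (T.P s (K (t - s)) - T.P s (G' (t - s)))) ht
    (ℓ.continuous.comp_continuousOn hcont)
    (fun s hs => ℓ.hasFDerivAt.comp_hasDerivWithinAt s (hasDerivWithinAt_comp_sub hs.1.le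
      (hG' (t - s) (sub_pos.2 hs.2)) (hK s (t - s) hs.1 (sub_pos.2 hs.2))))
    (fun s hs => by
      rw [← map_sub, hℓ]
      exact inner_nonneg_of_ae_nonneg hw (T.nonneg hs.1.le (hle (t - s) (sub_pos.2 hs.2))))
  simp only [sub_zero, sub_self, T.zero] at h1
  rw [← hℓ, map_sub]
  linarith

end SubMarkovSemigroup

/-! ### From distributional to classical `L`, and the weighted contraction -/

section WeakSolution

variable {E : Type*} [NormedAddCommGroup E] [NormedSpace ℝ E] [FiniteDimensional ℝ E]
  {X : Type*} [TopologicalSpace X] [T2Space X] [SigmaCompactSpace X] [ChartedSpace E X]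
  [IsManifold 𝓘(ℝ, E) ∞ X] [MeasurableSpace X] [BorelSpace X]
  {D : DiffusionOperator E X} {μ : Measure X} {Ω : Set X}

/-- If `L g = v` in the sense of distributions and `g` is smooth, then `L g = v` classically. -/
theorem ae_eq_L_of_forall_integral_eq (hμ : D.IsReversible μ Ω) (hΩ : ∀ᵐ x ∂μ, x ∈ Ω)
    (hreg : Ω ⊆ D.reg) (hopen : IsOpen Ω) {g : X → ℝ} (hg : ∀ x ∈ Ω, SmoothNear E g x)
    (v : Lp ℝ 2 μ)
    (h : ∀ φ ∈ testFunctions E Ω, ∫ x, v x * φ x ∂μ = ∫ x, g x * D.L φ x ∂μ) :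
    ∀ᵐ x ∂μ, v x = D.L g x := by
  have := ChartedSpace.locallyCompactSpace E X
  have hL : ∀ x ∈ Ω, ContinuousAt (D.L g) x := fun x hx =>
    (D.smooth x (hreg hx) g (hg x hx)).continuousAt
  have hloc : LocallyIntegrableOn (fun x => v x - D.L g x) Ω μ := by
    intro x hx
    obtain ⟨K, hK, hxK, hKΩ⟩ := exists_compact_subset hopen hx
    have hfin := hμ.finite_on_compacts K hK hKΩ
    have : IsFiniteMeasure (μ.restrict K) := ⟨by simpa using hfin⟩
    refine ⟨K, mem_nhdsWithin_of_mem_nhds (mem_interior_iff_mem_nhds.1 hxK), ?_⟩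
    refine (((Lp.memLp v).restrict K).integrable one_le_two).sub ?_
    exact ContinuousOn.integrableOn_of_subset_isCompact
      (fun y hy => (hL y (hKΩ hy)).continuousWithinAt) hK hK.measurableSet subset_rfl hfin.ne
  -- Symmetry moves `L` from the test function onto `g`; the fundamental lemma of the calculus of
  -- variations then applies.
  have hzero := hopen.ae_eq_zero_of_integral_contMDiff_smul_eq_zero 𝓘(ℝ, E) hloc ?_
  · filter_upwards [hzero, hΩ] with x h1 h2
    linarith [h1 h2]
  · intro φ h1 h2 h3
    have hφ : φ ∈ testFunctions E Ω := ⟨h1, h2, h3⟩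
    have hφ2 : MemLp φ 2 μ := by
      rw [memLp_two_iff_integrable_sq h1.continuous.aestronglyMeasurable]
      exact integrable_of_continuousAt hμ.finite_on_compacts hΩ hφ
        (fun x _ => (h1.continuous.pow 2).continuousAt)
        fun x _ hx => by simp [image_eq_zero_of_notMem_tsupport hx]
    have hi1 : Integrable (fun x => φ x * v x) μ := hφ2.integrable_mul (Lp.memLp v)
    have hi2 : Integrable (fun x => φ x * D.L g x) μ :=
      integrable_of_continuousAt hμ.finite_on_compacts hΩ hφ
        (fun x hx => h1.continuous.continuousAt.mul (hL x hx))
        fun x _ hx => by simp [image_eq_zero_of_notMem_tsupport hx]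
    simp only [smul_eq_mul, mul_sub]
    rw [integral_sub hi1 hi2, ← integral_mul_L_comm_of_smoothNear hμ hΩ hreg hopen hg hφ,
      ← h φ hφ]
    simp only [mul_comm (φ _), sub_self]

/-- The weighted contraction property, for a weight `W` with `W L W = 3 Γ(W)`. -/
theorem weightedContraction_of_mul_L_eq {𝓗 : Submodule ℝ (Lp ℝ 2 μ)}
    {T : SubMarkovSemigroup μ 𝓗} {W : X → ℝ} (hμ : D.IsReversible μ (D.regularSet W))
    (hΩ : ∀ᵐ x ∂μ, x ∈ D.regularSet W) (hT : T.IsGeneratedBy D (D.regularSet W))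
    (hW : ∀ᵐ x ∂μ, W x * D.L W x = 3 * D.Γ W W x) {f : X → ℝ} (hf : f ∈ techClass D T W) :
    WeightedContraction T W f := by
  obtain ⟨hf_test, u, g, G, K, hu, hg, hg_smooth, hG, hK, hGen, hG_cont, hG_diff⟩ := hf
  intro u' hu' t ht
  obtain rfl : u' = u := Subtype.ext (Lp.ext (hu'.trans hu.symm))
  obtain ⟨v, hv, huv⟩ := hT.extends_L f hf_test u' hu
  have hreg : D.regularSet W ⊆ D.reg := fun x hx => hx.1
  have hG_deriv : ∀ r, 0 < r → HasDerivAt G (deriv G r) r := fun r hr =>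
    ((hG_diff r hr).differentiableAt (Ioi_mem_nhds hr)).hasDerivAt
  -- `P_r v` is the generator applied to `P_r f`, hence its distributional `L`; smoothness of `g r`
  -- makes this classical.
  have hv_eq : ∀ r, 0 < r → ∀ᵐ x ∂μ, (T.P r v : Lp ℝ 2 μ) x = D.L (g r) x := by
    intro r hr
    refine ae_eq_L_of_forall_integral_eq hμ hΩ hreg (isOpen_regularSet D W) (hg_smooth r hr) _
      fun φ hφ => ?_
    rw [hT.acts_as_L _ _ (huv.map hr.le) φ hφ]
    refine integral_congr_ae ?_
    filter_upwards [hg r hr.le] with x hx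
    rw [hx]
  have hG_sq : ∀ r, 0 ≤ r → ∀ᵐ x ∂μ,
      (G r : Lp ℝ 2 μ) x = W x ^ 2 * (T.P r u' : Lp ℝ 2 μ) x ^ 2 := by
    intro r hr
    filter_upwards [hG r hr, hg r hr] with x h1 h2
    rw [h1, h2]
  have hG'_eq : ∀ r, 0 < r → ∀ᵐ x ∂μ,
      ((deriv G r : 𝓗) : Lp ℝ 2 μ) x = 2 * W x ^ 2 * g r x * D.L (g r) x := by
    intro r hr
    have h1 : HasDerivWithinAt (fun t => (T.P t u' : Lp ℝ 2 μ)) (T.P r v : Lp ℝ 2 μ) (Ioi r) r :=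
      𝓗.subtypeL.hasFDerivAt.comp_hasDerivWithinAt r (huv.hasDerivWithinAt hr.le)
    have h2 : HasDerivWithinAt (fun t => (G t : Lp ℝ 2 μ)) ((deriv G r : 𝓗) : Lp ℝ 2 μ) (Ioi r) r :=
      𝓗.subtypeL.hasFDerivAt.comp_hasDerivWithinAt r (hG_deriv r hr).hasDerivWithinAt
    filter_upwards [ae_eq_of_hasDerivWithinAt_sq h1 h2 fun t ht => hG_sq t (hr.le.trans ht),
      hv_eq r hr, hg r hr.le] with x h3 h4 h5
    rw [h3, h4, h5]
  -- The subsolution property `∂ᵣ G ≤ L G`: this is where `W L W = 3 Γ(W)` enters.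
  have hle : ∀ r, 0 < r → ∀ᵐ x ∂μ, 0 ≤ ((K r - deriv G r : 𝓗) : Lp ℝ 2 μ) x := by
    intro r hr
    filter_upwards [Lp.coeFn_sub (K r : Lp ℝ 2 μ) ((deriv G r : 𝓗) : Lp ℝ 2 μ), hK r hr, hG'_eq r hr,
      hΩ, hW] with x h1 h2 h3 h4 h5
    rw [Submodule.coe_sub, h1, Pi.sub_apply, h2, h3, sub_nonneg]
    exact D.le_L_sq_mul_sq h4.1 h4.2.1 (hg_smooth r hr x h4) h5
  have hcmp : ∀ᵐ x ∂μ, (G t : Lp ℝ 2 μ) x ≤ (T.P t (G 0) : Lp ℝ 2 μ) x := by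
    filter_upwards [SubMarkovSemigroup.ae_nonneg_sub_of_subsolution hG_cont hG_deriv hGen hle ht,
      Lp.coeFn_sub (T.P t (G 0) : Lp ℝ 2 μ) (G t : Lp ℝ 2 μ)] with x h1 h2
    rw [Submodule.coe_sub, h2, Pi.sub_apply] at h1
    linarith
  have hG0 : ∀ᵐ x ∂μ, (G 0 : Lp ℝ 2 μ) x = W x ^ 2 * f x ^ 2 := by
    filter_upwards [hG_sq 0 le_rfl, hu] with x h1 h2
    rw [h1, T.zero, h2]
  have hmass := T.mass_le t ht (G 0) (by
    filter_upwards [hG0] with x hx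
    rw [hx]
    positivity)
  have hsq : ∀ a b : ℝ, ‖a * b‖ₑ ^ (2 : ℝ) = ENNReal.ofReal (a ^ 2 * b ^ 2) := by
    intro a b
    rw [← mul_pow, ← sq_abs, ENNReal.ofReal_pow (abs_nonneg _), ← Real.norm_eq_abs,
      ofReal_norm, ← ENNReal.rpow_natCast]
    norm_num
  rw [eLpNorm_eq_lintegral_rpow_enorm_toReal two_ne_zero ENNReal.ofNat_ne_top,
    eLpNorm_eq_lintegral_rpow_enorm_toReal two_ne_zero ENNReal.ofNat_ne_top]
  refine ENNReal.rpow_le_rpow ?_ (by positivity)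
  simp only [ENNReal.toReal_ofNat, hsq]
  calc ∫⁻ x, ENNReal.ofReal (W x ^ 2 * (T.P t u' : Lp ℝ 2 μ) x ^ 2) ∂μ
      ≤ ∫⁻ x, ENNReal.ofReal ((T.P t (G 0) : Lp ℝ 2 μ) x) ∂μ := by
        refine lintegral_mono_ae ?_
        filter_upwards [hcmp, hG_sq t ht] with x h1 h2
        rw [← h2]
        exact ENNReal.ofReal_le_ofReal h1
    _ ≤ ∫⁻ x, ENNReal.ofReal ((G 0 : Lp ℝ 2 μ) x) ∂μ := hmass
    _ = ∫⁻ x, ENNReal.ofReal (W x ^ 2 * f x ^ 2) ∂μ := by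
        refine lintegral_congr_ae ?_
        filter_upwards [hG0] with x hx
        rw [hx]

end WeakSolution

/-! ### Recovering `ψ` from `W = ψ^((Q-2)/2)` -/

section Multiplier

variable {E : Type*} [NormedAddCommGroup E] [NormedSpace ℝ E]
  {X : Type*} [TopologicalSpace X] [ChartedSpace E X] {D : DiffusionOperator E X}
  {ψ : X → ℝ} {Q : ℝ} {x : X}

theorem pos_of_mem_regularSet_multiplier (hQ : Q ≠ 2) (hψ : ∀ x, 0 ≤ ψ x)
    (hx : x ∈ D.regularSet (multiplier ψ Q)) : 0 < ψ x := by
  refine (hψ x).lt_of_ne fun h => ?_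
  have h1 := hx.2.2
  -- For `Q < 2` this uses the convention that `0` to a negative power is `0`, so zeros of `ψ` are
  -- zeros of `W` in either case.
  rw [multiplier, ← h, Real.zero_rpow] at h1
  · exact lt_irrefl _ h1
  · intro h2
    apply hQ
    linarith

/-- Since `Q ≠ 2`, the power can be inverted: `ψ = W^(2/(Q-2))`, and `W` is smooth and positive
there. -/
theorem smoothNear_of_mem_regularSet_multiplier (hQ : Q ≠ 2) (hψ : ∀ x, 0 ≤ ψ x)
    (hx : x ∈ D.regularSet (multiplier ψ Q)) : SmoothNear E ψ x := by
  refine (hx.2.1.rpow hx.2.2 ((Q - 2) / 2)⁻¹).congr (Eventually.of_forall fun y => ?_)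
  have h : (Q - 2) / 2 ≠ 0 := by
    intro h
    apply hQ
    linarith
  simp only [multiplier]
  rw [Real.rpow_rpow_inv (hψ y) h]

theorem mem_regularSet_multiplier (hx : x ∈ D.reg) (hψ : SmoothNear E ψ x) (hpos : 0 < ψ x) :
    x ∈ D.regularSet (multiplier ψ Q) :=
  ⟨hx, hψ.rpow hpos _, Real.rpow_pos_of_pos hpos _⟩

end Multiplier

end WeightedHardy

open WeightedHardy in
theorem mainTheorem3
    {E : Type*} [NormedAddCommGroup E] [NormedSpace ℝ E] [FiniteDimensional ℝ E]
    {X : Type*} [TopologicalSpace X] [T2Space X] [SigmaCompactSpace X] [ChartedSpace E X]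
    [IsManifold 𝓘(ℝ, E) ∞ X] [MeasurableSpace X] [BorelSpace X]
    (D : DiffusionOperator E X) (μ : Measure X)
    (𝓗 : Submodule ℝ (Lp ℝ 2 μ)) (h𝓗 : IsClosed (𝓗 : Set (Lp ℝ 2 μ)))
    (T : SubMarkovSemigroup μ 𝓗) (ψ : X → ℝ) (Q : ℝ) (hQ : Q ≠ 2)
    (hD : ∀ᵐ x ∂μ, x ∈ D.reg)
    (hψ_nonneg : ∀ x, 0 ≤ ψ x)
    (hψ_smooth : ∀ᵐ x ∂μ, SmoothNear E ψ x)
    (hψ_ne : ∀ᵐ x ∂μ, ψ x ≠ 0)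
    (hψ : ∀ᵐ x ∂μ, D.L ψ x = (Q - 1) / ψ x * D.Γ ψ ψ x)
    (hμ : D.IsReversible μ (D.regularSet (multiplier ψ Q)))
    (hT : T.IsGeneratedBy D (D.regularSet (multiplier ψ Q))) :
    List.TFAE
      [∀ f ∈ techClass D T (multiplier ψ Q), WeightedContraction T (multiplier ψ Q) f,
       ∀ f ∈ techClass D T (multiplier ψ Q),
        HardyInequality D μ ψ (Q - 2) ((1 / (Q - 2)) ^ 2) f,
       ∀ α : ℝ, Q + α ≠ 2 → ∀ f ∈ techClass D T (multiplier ψ Q),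
        HardyInequality D μ ψ α ((2 / (Q + α - 2)) ^ 2) f] ∧
    ∀ α : ℝ, Q + α ≠ 2 →
      ((∀ f ∈ techClass D T (multiplier ψ Q),
        HardyInequality D μ ψ (Q - 2) ((1 / (Q - 2)) ^ 2) f) ↔
       ∀ f ∈ techClass D T (multiplier ψ Q),
        HardyInequality D μ ψ α ((2 / (Q + α - 2)) ^ 2) f) := by
  have hreg : D.regularSet (multiplier ψ Q) ⊆ D.reg := fun x hx => hx.1
  have hΩ : ∀ᵐ x ∂μ, x ∈ D.regularSet (multiplier ψ Q) := by
    filter_upwards [hD, hψ_smooth, hψ_ne] with x h1 h2 h3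
    exact mem_regularSet_multiplier h1 h2 ((hψ_nonneg x).lt_of_ne' h3)
  have hψ_pos : ∀ x ∈ D.regularSet (multiplier ψ Q), 0 < ψ x := fun x hx =>
    pos_of_mem_regularSet_multiplier hQ hψ_nonneg hx
  have hψ_near : ∀ x ∈ D.regularSet (multiplier ψ Q), SmoothNear E ψ x := fun x hx =>
    smoothNear_of_mem_regularSet_multiplier hQ hψ_nonneg hx
  have hW : ∀ᵐ x ∂μ, multiplier ψ Q x * D.L (multiplier ψ Q) x =
      3 * D.Γ (multiplier ψ Q) (multiplier ψ Q) x := by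
    filter_upwards [hΩ, hψ] with x hx h
    exact multiplier_mul_L D hx.1 (hψ_near x hx) (hψ_pos x hx) h
  have contraction : ∀ f ∈ techClass D T (multiplier ψ Q),
      WeightedContraction T (multiplier ψ Q) f := fun f hf =>
    weightedContraction_of_mul_L_eq hμ hΩ hT hW hf
  have hardy : ∀ α : ℝ, Q + α ≠ 2 → ∀ f ∈ techClass D T (multiplier ψ Q),
      HardyInequality D μ ψ α ((2 / (Q + α - 2)) ^ 2) f := fun α hα f hf =>
    hardyInequality_of_testFunction hμ hΩ hreg hα hψ_pos hψ_near hψ hf.1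
  have hardy_two : ∀ f ∈ techClass D T (multiplier ψ Q),
      HardyInequality D μ ψ (Q - 2) ((1 / (Q - 2)) ^ 2) f := by
    have hQ' : Q - 2 ≠ 0 := sub_ne_zero.2 hQ
    -- The unparametrised Hardy inequality is the case `α = Q - 2`.
    have h : 2 / (Q + (Q - 2) - 2) = 1 / (Q - 2) := by
      rw [show Q + (Q - 2) - 2 = 2 * (Q - 2) by ring]
      field_simp
    rw [← h]
    exact hardy (Q - 2) fun h => hQ' (by linarith)
  refine ⟨?_, fun α hα => ⟨fun _ => hardy α hα, fun _ => hardy_two⟩⟩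
  -- Each implication discards its premise, as every conclusion is already established.
  tfae_have 1 → 2 := fun _ => hardy_two
  tfae_have 2 → 3 := fun _ => hardy
  tfae_have 3 → 1 := fun _ => contraction
  tfae_finish
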